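/- Let $V$ be a countable set and consider a time-homogeneous Markov chain on $V$ with transition probabilities $p(u,v)$. Let $\partial\Gamma\subset V$ be an arbitrary set of states (the boundary), and let $\mathrm{int}\,\Gamma=V\setminus\partial\Gamma$. A trajectory $v_0,v_1,v_2,\dots$ *first hits the boundary* at time $n$ if $n>0$, $v_n\in\partial\Gamma$ and $v_m\in\mathrm{int}\,\Gamma$ for all $0<m<n$ (so a chain started on the boundary has not hit it at time $0$). For $a\in V$ and $B\subset\partial\Gamma$ let $X(a,B)$ be the probability that the chain started at $a$ first hits the boundary at a state of $B$. A *possible trajectory connecting $a$ to $B$* is a finite sequence $a=v_0,v_1,\dots,v_n$ with $n>0$, $p(v_m,v_{m+1})\neq0$ for all $m<n$, $v_m\in\mathrm{int}\,\Gamma$ for $0<m<n$, and $v_n\in B$. For a finite sequence $\pi=(v_0,\dots,v_n)$ let $\mathrm{LE}(\pi)$ be its loop-erased part, obtained by erasing the loops of $\pi$ in chronological order. If $\pi$ starts at the boundary state at which it first hits the boundary, i.e. $v_0=v_n\in\partial\Gamma$, then the initial and the terminal occurrence of this state are regarded as different vertices (so that the closed walk $\pi$ as a whole is not erased as a loop).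 **Theorem.** Let $a_1,\dots,a_k\in V$ be distinct states and let $B_1,\dots,B_k\subset\partial\Gamma$ be pairwise disjoint subsets such that, whenever $i<i'$ and $j'<j$, any possible trajectory connecting $a_i$ to $B_j$ has a common state in $\mathrm{int}\,\Gamma$ with any possible trajectory connecting $a_{i'}$ to $B_{j'}$. Then $\det\big(X(a_i,B_j)\big)_{i,j=1}^k\ge 0$, and moreover the matrix $\big(X(a_i,B_j)\big)_{i,j=1}^k$ is totally nonnegative, i.e. all its minors are nonnegative. Furthermore, $\det\big(X(a_i,B_j)\big)$ is equal to the probability that $k$ independent trajectories $\pi_1,\dots,\pi_k$ of the chain, started at $a_1,\dots,a_k$ respectively, first hit the boundary at states belonging to $B_1,\dots,B_k$ respectively and, each trajectory being stopped when it first hits the boundary, $\pi_{i+1}$ has no common state with $\mathrm{LE}(\pi_i)$ in $\mathrm{int}\,\Gamma$, for $i=1,\dots,k-1$. -/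

import Mathlib

open MeasureTheory ProbabilityTheory

namespace HittingLE

/-! ### Loop erasure -/

section LoopErasure

open scoped Classical in
/-- One step of chronological loop erasure: the self-avoiding walk `L` is extended by the
vertex `v`. If `v` already lies on `L`, the loop just closed at `v` is removed. -/
noncomputable def eraseStep {V : Type*} (L : List V) (v : V) : List V :=
  L.takeWhile (fun u => decide (u ≠ v)) ++ [v]

/-- The loop-erased part `LE(l)` of a walk given by its list of vertices: loops are erased in
the order in which they are created. See `loopErase_of_nodup` and `loopErase_of_first_loop`
for the recursive characterization. -/
noncomputable def loopErase {V : Type*} (l : List V) : List V :=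
  l.foldl eraseStep []

theorem eraseStep_of_notMem {V : Type*} {L : List V} {v : V} (h : v ∉ L) :
    eraseStep L v = L ++ [v] := by
  unfold eraseStep
  congr 1
  rw [List.takeWhile_eq_self_iff]
  intro u hu
  simp only [decide_eq_true_eq]
  rintro rfl
  exact h hu

theorem loopErase_append_singleton {V : Type*} (l : List V) (v : V) :
    loopErase (l ++ [v]) = eraseStep (loopErase l) v := by
  simp [loopErase, List.foldl_append]

/-- A walk without self-intersections is its own loop-erased part. -/
theorem loopErase_of_nodup {V : Type*} (l : List V) (h : l.Nodup) : loopErase l = l := by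
  induction l using List.reverseRecOn with
  | nil => rfl
  | append_singleton l v ih =>
    rw [List.nodup_append] at h
    obtain ⟨h1, -, h3⟩ := h
    rw [loopErase_append_singleton, ih h1, eraseStep_of_notMem]
    intro hv
    exact h3 v hv v (by simp) rfl

/-- If the first loop made by a walk is `v, q, v`, then removing it does not change the
loop-erased part. -/
theorem loopErase_of_first_loop {V : Type*} (p q r : List V) (v : V)
    (h : (p ++ v :: q).Nodup) :
    loopErase (p ++ v :: q ++ v :: r) = loopErase (p ++ v :: r) := by
  have hp : v ∉ p := by
    intro hv
    rw [List.nodup_append] at h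
    exact h.2.2 v hv v (by simp) rfl
  have h0 : p.Nodup := (List.nodup_append.1 h).1
  have e1 : loopErase (p ++ v :: q ++ [v]) = p ++ [v] := by
    rw [loopErase_append_singleton, loopErase_of_nodup _ h]
    unfold eraseStep
    congr 1
    rw [List.takeWhile_append_of_pos]
    · simp
    · intro u hu
      simp only [decide_eq_true_eq]
      rintro rfl
      exact hp hu
  have e2 : loopErase (p ++ [v]) = p ++ [v] := by
    rw [loopErase_append_singleton, loopErase_of_nodup _ h0, eraseStep_of_notMem hp]
  have key : ∀ l : List V, loopErase (l ++ r) = r.foldl eraseStep (loopErase l) := by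
    intro l
    simp [loopErase, List.foldl_append]
  have a1 : p ++ v :: q ++ v :: r = (p ++ v :: q ++ [v]) ++ r := by simp
  have a2 : p ++ v :: r = (p ++ [v]) ++ r := by simp
  rw [a1, a2, key, key, e1, e2]

theorem mem_of_mem_loopErase {V : Type*} {l : List V} {v : V} (h : v ∈ loopErase l) :
    v ∈ l := by
  induction l using List.reverseRecOn with
  | nil => simp [loopErase] at h
  | append_singleton l u ih =>
    rw [loopErase_append_singleton, eraseStep, List.mem_append] at h
    rcases h with h | h
    · exact List.mem_append_left _ (ih ((List.takeWhile_prefix _).subset h))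
    · exact List.mem_append_right _ h

end LoopErasure

/-! ### Hitting the boundary -/

section Hitting

variable {V : Type*}

/-- The trajectory `ω` hits the boundary `bd` for the first time at time `n`. Only positive
times count: a trajectory which starts on the boundary has not hit it at time `0`. -/
def HitsAt (bd : Set V) (ω : ℕ → V) (n : ℕ) : Prop :=
  0 < n ∧ ω n ∈ bd ∧ ∀ m, 0 < m → m < n → ω m ∉ bd

/-- The list of states `ω 0, …, ω (n - 1)`. -/
def walkBefore (ω : ℕ → V) (n : ℕ) : List V := (List.range n).map ω

/-- The loop-erased part of the trajectory `ω` stopped at time `n` when it first hits the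
boundary. The terminal visit to the boundary is kept apart from the starting point,
so that nothing is erased at the terminal time, even when the trajectory has started at the
boundary state at which it ends. In all other cases this is the usual loop-erased part of
`ω 0, …, ω n`, see `loopErasedHit_eq_loopErase`. -/
noncomputable def loopErasedHit (ω : ℕ → V) (n : ℕ) : List V :=
  loopErase (walkBefore ω n) ++ [ω n]

theorem loopErasedHit_eq_loopErase {bd : Set V} {ω : ℕ → V} {n : ℕ}
    (h : HitsAt bd ω n) (hne : ω n ≠ ω 0) :
    loopErasedHit ω n = loopErase (walkBefore ω (n + 1)) := by
  have e : walkBefore ω (n + 1) = walkBefore ω n ++ [ω n] := by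
    simp [walkBefore, List.range_succ]
  rw [e, loopErase_append_singleton, eraseStep_of_notMem, loopErasedHit]
  intro hmem
  have h2 := mem_of_mem_loopErase hmem
  simp only [walkBefore, List.mem_map, List.mem_range] at h2
  obtain ⟨m, hm, he⟩ := h2
  rcases Nat.eq_zero_or_pos m with rfl | hpos
  · exact hne he.symm
  · exact h.2.2 m hpos hm (he ▸ h.2.1)

end Hitting

/-! ### Markov chains -/

section MarkovChain

variable {V : Type*} [MeasurableSpace V]

/-- The law, on the space of trajectories `ℕ → V`, of the time-homogeneous Markov chain with
transition kernel `P` (the transition probabilities are `p(u, v) = P u {v}`) started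
at the state `a`. -/
noncomputable def pathLaw (P : Kernel V V) [IsMarkovKernel P] (a : V) : Measure (ℕ → V) :=
  Kernel.traj (X := fun _ : ℕ => V)
    (fun n => P.comap (fun h : (i : Finset.Iic n) → V => h ⟨n, Finset.mem_Iic.2 le_rfl⟩)
      (measurable_pi_apply _))
    0 (fun _ => a)

instance pathLaw_isProbabilityMeasure (P : Kernel V V) [IsMarkovKernel P] (a : V) :
    IsProbabilityMeasure (pathLaw P a) := by
  unfold pathLaw
  infer_instance

/-- `X(a, B)`: the probability that the chain started at `a` first hits the boundary `bd`
(at a positive time) at a state of `B`. -/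
noncomputable def hitProb (P : Kernel V V) [IsMarkovKernel P] (bd : Set V) (a : V)
    (B : Set V) : ℝ :=
  (pathLaw P a).real {ω | ∃ n, HitsAt bd ω n ∧ ω n ∈ B}

/-- `ω 0, …, ω n` is a possible trajectory of the chain, connecting `a` to `B` through the
interior: all its transitions have nonzero probability, it starts at `a`, and it first hits
the boundary at time `n`, at a state of `B`. -/
structure IsPossibleTrajectory (P : Kernel V V) (bd : Set V) (a : V) (B : Set V)
    (ω : ℕ → V) (n : ℕ) : Prop where
  start : ω 0 = a
  hits : HitsAt bd ω n
  target : ω n ∈ B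
  step : ∀ m < n, P (ω m) {ω (m + 1)} ≠ 0

/-- Whenever `i < i'` and `j' < j`, any possible trajectory connecting `a i` to `B j`
meets any possible trajectory connecting `a i'` to `B j'` at an interior state. -/
def CrossingHypothesis (P : Kernel V V) (bd : Set V) {k : ℕ} (a : Fin k → V)
    (B : Fin k → Set V) : Prop :=
  ∀ i i' j j' : Fin k, i < i' → j' < j →
    ∀ (ω : ℕ → V) (n : ℕ) (ω' : ℕ → V) (n' : ℕ),
      IsPossibleTrajectory P bd (a i) (B j) ω n →
      IsPossibleTrajectory P bd (a i') (B j') ω' n' →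
      ∃ m ≤ n, ∃ m' ≤ n', ω m = ω' m' ∧ ω m ∉ bd

/-- The event, for a family `π` of `k` trajectories: `π i` first hits the boundary at a state
of `B i` for all `i` (at time `n i`), and `π (i + 1)`, up to its hitting time, has no
interior state in common with the loop-erased part of `π i`. -/
def nonCrossingEvent (bd : Set V) {k : ℕ} (B : Fin k → Set V) : Set (Fin k → ℕ → V) :=
  {π | ∃ n : Fin k → ℕ,
    (∀ i, HitsAt bd (π i) (n i) ∧ π i (n i) ∈ B i) ∧
    ∀ i j : Fin k, (i : ℕ) + 1 = j →
      ∀ v ∉ bd, v ∈ loopErasedHit (π i) (n i) → ∀ m ≤ n j, π j m ≠ v}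

end MarkovChain

/-- All minors (with rows and columns taken in increasing order) are nonnegative. -/
def TotallyNonneg {k : ℕ} (M : Matrix (Fin k) (Fin k) ℝ) : Prop :=
  ∀ (m : ℕ) (r c : Fin m → Fin k), StrictMono r → StrictMono c → 0 ≤ (M.submatrix r c).det

end HittingLE

/-! This is a Lindström–Gessel–Viennot argument in Fomin's loop-erased form. A stopped trajectory is
a pair (walk before the hit, hitting state) weighted by its transition probabilities. Keeping the
last state apart makes loop erasure treat a common boundary start and end as distinct. By
independence, the `σ`-term of the determinant is the total weight of families joining `a i` to `B (σ
i)` (`prod_hitProb`).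

Call a family noncrossing if no `LE(W i)` meets a later `W j` in the interior. A crossing family has
a canonical first crossing `(i, j, v)`. Exchanging the parts of `W i` and `W j` after their last
visits to `v` preserves weight and first crossing (`FirstCrossing.swapTails`), is an involution, and
multiplies `σ` by a transposition. Crossing families therefore cancel
(`sum_sign_familyMass_crossing`).

A noncrossing family of positive weight forces `σ = 1`: at an inversion, the crossing hypothesis
applied to `LE(W i)`, itself a possible trajectory, and `W i'` yields a forbidden meeting
(`NonCrossing.perm_eq_one`). Under the hypothesis, noncrossing of consecutive walks already implies
noncrossing of all pairs (`ConsecutiveNonCrossing.nonCrossing`), so the surviving weight is the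
stated probability. Minors inherit the hypothesis, hence are probabilities too. -/

namespace HittingLE

/-! ### Cylinder probabilities of the chain. -/

section Cylinder

variable {V : Type*}

theorem walkBefore_succ (ω : ℕ → V) (n : ℕ) : walkBefore ω (n + 1) = walkBefore ω n ++ [ω n] := by
  simp [walkBefore, List.range_succ]

@[simp]
theorem length_walkBefore (ω : ℕ → V) (n : ℕ) : (walkBefore ω n).length = n := by
  simp [walkBefore]

theorem mem_walkBefore {ω : ℕ → V} {n : ℕ} {v : V} : v ∈ walkBefore ω n ↔ ∃ m < n, ω m = v := by
  simp [walkBefore]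

variable [MeasurableSpace V]

/-- The product of the transition probabilities along a walk. -/
noncomputable def walkWeight (P : Kernel V V) : List V → ENNReal
  | [] => 1
  | [_] => 1
  | u :: v :: t => P u {v} * walkWeight P (v :: t)

theorem walkWeight_append (P : Kernel V V) (p : List V) (v : V) (q : List V) :
    walkWeight P (p ++ v :: q) = walkWeight P (p ++ [v]) * walkWeight P (v :: q) := by
  induction p with
  | nil => simp [walkWeight]
  | cons u p ih =>
    cases p with
    | nil => simp [walkWeight]
    | cons w p =>
      simp only [List.cons_append, walkWeight] at ih ⊢
      rw [ih, mul_assoc]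

theorem walkWeight_ne_zero {P : Kernel V V} {l : List V} :
    walkWeight P l ≠ 0 ↔ List.IsChain (fun u v => P u {v} ≠ 0) l := by
  induction l with
  | nil => simp [walkWeight]
  | cons u l ih =>
    cases l with
    | nil => simp [walkWeight]
    | cons v l => simp only [walkWeight, List.isChain_cons_cons, ← ih, mul_ne_zero_iff]

theorem measurableSet_walkBefore_eq [DiscreteMeasurableSpace V] (n : ℕ) (l : List V) :
    MeasurableSet {ω : ℕ → V | walkBefore ω n = l} := by
  induction n generalizing l with
  | zero =>
    by_cases h : l = [] <;> simp [walkBefore, h, eq_comm]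
  | succ n ih =>
    rcases List.eq_nil_or_concat l with rfl | ⟨l, v, rfl⟩
    · simp [walkBefore_succ]
    · have : {ω : ℕ → V | walkBefore ω (n + 1) = l ++ [v]} =
          {ω | walkBefore ω n = l} ∩ (fun ω : ℕ → V => ω n) ⁻¹' {v} := by
        ext ω
        simp [walkBefore_succ]
      rw [List.concat_eq_append, this]
      exact (ih l).inter (measurable_pi_apply n (MeasurableSet.of_discrete))

open scoped Classical in
theorem pathLaw_start [DiscreteMeasurableSpace V] (P : Kernel V V) [IsMarkovKernel P] (a v : V) :
    pathLaw P a {ω | ω 0 = v} = if v = a then 1 else 0 := by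
  have h := Kernel.traj_map_frestrictLe_apply (X := fun _ : ℕ => V)
    (κ := fun n => P.comap (fun h : (i : Finset.Iic n) → V => h ⟨n, Finset.mem_Iic.2 le_rfl⟩)
      (measurable_pi_apply _)) 0 0 (fun _ => a)
  rw [Kernel.partialTraj_self, Kernel.id_apply] at h
  have hm : Measurable (fun z : (i : Finset.Iic 0) → V => z ⟨0, Finset.mem_Iic.2 le_rfl⟩) :=
    measurable_pi_apply _
  have hS : MeasurableSet {z : (i : Finset.Iic 0) → V | z ⟨0, Finset.mem_Iic.2 le_rfl⟩ = v} :=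
    hm (MeasurableSet.of_discrete (s := {v}))
  have h2 := congrArg (fun m => m {z | z ⟨0, Finset.mem_Iic.2 le_rfl⟩ = v}) h
  simp only [Measure.dirac_apply' _ hS] at h2
  rw [Measure.map_apply (by fun_prop) hS] at h2
  unfold pathLaw
  refine Eq.trans ?_ (h2.trans ?_)
  · rfl
  · by_cases hv : v = a <;> simp [Set.indicator, hv, eq_comm]

/-- The law up to time `n + 1` is the law up to time `n` composed with the step kernel. On this
cylinder the kernel sees only the last state `u`, so the integral is of a constant. -/
theorem pathLaw_succ [Countable V] [DiscreteMeasurableSpace V] (P : Kernel V V) [IsMarkovKernel P]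
    (a : V) (l : List V) (u v : V) :
    pathLaw P a {ω | walkBefore ω (l.length + 2) = l ++ [u, v]} =
      pathLaw P a {ω | walkBefore ω (l.length + 1) = l ++ [u]} * P u {v} := by
  set n := l.length with hn
  have h := Kernel.partialTraj_compProd_eq_map_traj (X := fun _ : ℕ => V)
    (κ := fun n => P.comap (fun h : (i : Finset.Iic n) → V => h ⟨n, Finset.mem_Iic.2 le_rfl⟩)
      (measurable_pi_apply _)) (Nat.zero_le n) (x₀ := fun _ => a)
  rw [← Kernel.traj_map_frestrictLe_apply] at h
  -- The default `u` is never reached: all indices in the range are at most `n`.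
  let S : Set ((i : Finset.Iic n) → V) :=
    {z | (List.range (n + 1)).map
      (fun i => if h : i ∈ Finset.Iic n then z ⟨i, h⟩ else u) = l ++ [u]}
  have hmap : ∀ ω : ℕ → V, (List.range (n + 1)).map
      (fun i => if h : i ∈ Finset.Iic n then (Preorder.frestrictLe n ω) ⟨i, h⟩ else u) =
        walkBefore ω (n + 1) := by
    intro ω
    refine List.map_congr_left fun i hi => ?_
    rw [List.mem_range] at hi
    rw [dif_pos (Finset.mem_Iic.2 (by omega))]
    rfl
  have hS : MeasurableSet S := MeasurableSet.of_discrete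
  have hpre : Preorder.frestrictLe n ⁻¹' S = {ω : ℕ → V | walkBefore ω (n + 1) = l ++ [u]} := by
    ext ω
    change (List.range (n + 1)).map _ = _ ↔ _
    rw [hmap]
    rfl
  have h2 := congrArg (fun m => m (S ×ˢ {v})) h
  rw [Measure.compProd_apply_prod hS MeasurableSet.of_discrete,
    Measure.map_apply (by fun_prop) (hS.prod MeasurableSet.of_discrete)] at h2
  have hlast : ∀ z ∈ S, z ⟨n, Finset.mem_Iic.2 le_rfl⟩ = u := by
    intro z hz
    change (List.range (n + 1)).map _ = _ at hz
    rw [List.range_succ, List.map_append] at hz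
    have := (List.append_inj' hz rfl).2
    simpa using this
  rw [setLIntegral_congr_fun (g := fun _ => P u {v}) hS (fun z hz => by
    rw [Kernel.comap_apply, hlast z hz]), setLIntegral_const,
    Measure.map_apply (by fun_prop) hS, hpre] at h2
  unfold pathLaw
  rw [mul_comm, h2]
  congr 1
  ext ω
  have : walkBefore ω (n + 2) = l ++ [u, v] ↔ walkBefore ω (n + 1) = l ++ [u] ∧ ω (n + 1) = v := by
    rw [walkBefore_succ, show l ++ [u, v] = (l ++ [u]) ++ [v] by simp]
    constructor
    · intro h
      have := List.append_inj' h rfl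
      simpa using this
    · rintro ⟨h, rfl⟩
      rw [h]
  change walkBefore ω (n + 2) = l ++ [u, v] ↔ ω ∈ Preorder.frestrictLe n ⁻¹' S ∧ _
  rw [hpre, this]
  rfl

open scoped Classical in
theorem pathLaw_walkBefore [Countable V] [DiscreteMeasurableSpace V] (P : Kernel V V)
    [IsMarkovKernel P] (a : V) (l : List V) (v : V) :
    pathLaw P a {ω | walkBefore ω (l.length + 1) = l ++ [v]} =
      if (l ++ [v]).head? = some a then walkWeight P (l ++ [v]) else 0 := by
  induction l using List.reverseRecOn generalizing v with
  | nil => simpa [walkBefore, walkWeight] using pathLaw_start P a v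
  | append_singleton l u ih =>
    have h := pathLaw_succ P a l u v
    rw [ih] at h
    have hh : ((l ++ [u]) ++ [v]).head? = (l ++ [u]).head? := by
      cases l <;> rfl
    rw [hh, List.length_append, List.length_singleton]
    rw [show l ++ [u] ++ [v] = l ++ [u, v] by simp, h, walkWeight_append P l u [v]]
    split_ifs <;> simp [walkWeight]

end Cylinder

/-! ### Walks stopped at the boundary, and their weights. -/

section HittingWalks

variable {V : Type*}

/-- `(l, b)` is a walk `l, b` which starts at `a` and first hits the boundary at its end `b`. -/
def IsHittingWalk (bd : Set V) (a : V) (w : List V × V) : Prop :=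
  w.1.head? = some a ∧ (∀ x ∈ w.1.tail, x ∉ bd) ∧ w.2 ∈ bd

/-- The trajectories which first hit the boundary after having followed the walk `w`. -/
def hitCylinder (bd : Set V) (w : List V × V) : Set (ℕ → V) :=
  {ω | HitsAt bd ω w.1.length ∧ walkBefore ω w.1.length = w.1 ∧ ω w.1.length = w.2}

theorem HitsAt.unique {bd : Set V} {ω : ℕ → V} {m n : ℕ} (hm : HitsAt bd ω m)
    (hn : HitsAt bd ω n) : m = n := by
  rcases lt_trichotomy m n with h | h | h
  · exact absurd hm.2.1 (hn.2.2 m hm.1 h)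
  · exact h
  · exact absurd hn.2.1 (hm.2.2 n hn.1 h)

theorem mem_tail_walkBefore {ω : ℕ → V} {n : ℕ} {v : V} :
    v ∈ (walkBefore ω n).tail ↔ ∃ m, 0 < m ∧ m < n ∧ ω m = v := by
  simp only [walkBefore, List.mem_iff_getElem, List.getElem_tail, List.length_tail,
    List.length_map, List.length_range, List.getElem_map, List.getElem_range]
  constructor
  · rintro ⟨i, hi, h⟩
    exact ⟨i + 1, by omega, by omega, h⟩
  · rintro ⟨m, h0, hm, h⟩
    refine ⟨m - 1, by omega, ?_⟩
    rwa [Nat.sub_add_cancel h0]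

theorem hitsAt_iff {bd : Set V} {ω : ℕ → V} {n : ℕ} :
    HitsAt bd ω n ↔ 0 < n ∧ ω n ∈ bd ∧ ∀ x ∈ (walkBefore ω n).tail, x ∉ bd := by
  refine and_congr_right fun _ => and_congr_right fun _ => ?_
  constructor
  · intro h x hx
    obtain ⟨m, h0, hm, rfl⟩ := mem_tail_walkBefore.1 hx
    exact h m h0 hm
  · intro h m h0 hm
    exact h _ (mem_tail_walkBefore.2 ⟨m, h0, hm, rfl⟩)

theorem HitsAt.mem_hitCylinder {bd : Set V} {ω : ℕ → V} {n : ℕ} (h : HitsAt bd ω n) :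
    ω ∈ hitCylinder bd (walkBefore ω n, ω n) := by
  simp [hitCylinder, h]

theorem eq_of_mem_hitCylinder {bd : Set V} {ω : ℕ → V} {n : ℕ} {w : List V × V}
    (h : HitsAt bd ω n) (hw : ω ∈ hitCylinder bd w) : w = (walkBefore ω n, ω n) := by
  obtain ⟨h1, h2, h3⟩ := hw
  have := h1.unique h
  rw [this] at h2 h3
  exact Prod.ext h2.symm h3.symm

theorem head?_append_of_ne_nil {l : List V} (h : l ≠ []) (l' : List V) :
    (l ++ l').head? = l.head? := by
  cases l <;> simp_all

theorem hitCylinder_eq_of_isHittingWalk {bd : Set V} {a : V} {w : List V × V}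
    (h : IsHittingWalk bd a w) :
    hitCylinder bd w = {ω | walkBefore ω (w.1.length + 1) = w.1 ++ [w.2]} := by
  obtain ⟨h1, h2, h3⟩ := h
  have hl : 0 < w.1.length := by
    rw [List.length_pos_iff]
    rintro h
    simp [h] at h1
  ext ω
  have : walkBefore ω (w.1.length + 1) = w.1 ++ [w.2] ↔
      walkBefore ω w.1.length = w.1 ∧ ω w.1.length = w.2 := by
    rw [walkBefore_succ]
    constructor
    · intro h
      have := List.append_inj h (by simp)
      simpa using this
    · rintro ⟨h, h'⟩
      rw [h, h']
  rw [Set.mem_ofPred_eq, this]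
  refine ⟨fun h => h.2, fun h => ⟨?_, h⟩⟩
  rw [hitsAt_iff, h.1, h.2]
  exact ⟨hl, h3, h2⟩

/-- The trajectories in the family `π` first hit the boundary after having followed the walks of
a family which belongs to `F`. -/
def familyEvent {k : ℕ} (bd : Set V) (F : Set (Fin k → List V × V)) : Set (Fin k → ℕ → V) :=
  {π | ∃ W ∈ F, ∀ i, π i ∈ hitCylinder bd (W i)}

theorem mem_familyEvent {k : ℕ} {bd : Set V} {F : Set (Fin k → List V × V)} {π : Fin k → ℕ → V} :
    π ∈ familyEvent bd F ↔ ∃ n : Fin k → ℕ, (∀ i, HitsAt bd (π i) (n i)) ∧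
      (fun i => (walkBefore (π i) (n i), π i (n i))) ∈ F := by
  constructor
  · rintro ⟨W, hW, h⟩
    refine ⟨fun i => (W i).1.length, fun i => (h i).1, ?_⟩
    convert hW using 2 with i
    exact Prod.ext (h i).2.1 (h i).2.2
  · rintro ⟨n, h, hF⟩
    exact ⟨_, hF, fun i => (h i).mem_hitCylinder⟩

variable [MeasurableSpace V]

open scoped Classical in
/-- The probability that the chain started at `a` first hits the boundary after having followed
the walk `w`. -/
noncomputable def hitWeight (P : Kernel V V) (bd : Set V) (a : V) (w : List V × V) : ENNReal :=
  if IsHittingWalk bd a w then walkWeight P (w.1 ++ [w.2]) else 0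

/-- Once the walk is prescribed, first hitting is a condition on `w` alone, constant in `ω`. -/
theorem measurableSet_hitCylinder [DiscreteMeasurableSpace V] (bd : Set V) (w : List V × V) :
    MeasurableSet (hitCylinder bd w) := by
  have : hitCylinder bd w = {ω | walkBefore ω w.1.length = w.1} ∩
      ((fun ω : ℕ → V => ω w.1.length) ⁻¹' {w.2} ∩
        {_ω | 0 < w.1.length ∧ w.2 ∈ bd ∧ ∀ x ∈ w.1.tail, x ∉ bd}) := by
    ext ω
    simp only [hitCylinder, Set.mem_ofPred_eq, Set.mem_inter_iff, Set.mem_preimage,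
      Set.mem_singleton_iff, hitsAt_iff]
    constructor
    · rintro ⟨h1, h2, h3⟩
      rw [h2, h3] at h1
      exact ⟨h2, h3, h1⟩
    · rintro ⟨h2, h3, h1⟩
      rw [h2, h3]
      exact ⟨h1, rfl, rfl⟩
  rw [this]
  exact (measurableSet_walkBefore_eq _ _).inter
    ((measurable_pi_apply _ MeasurableSet.of_discrete).inter (MeasurableSet.const _))

theorem pathLaw_hitCylinder [Countable V] [DiscreteMeasurableSpace V] (P : Kernel V V)
    [IsMarkovKernel P] (bd : Set V) (a : V) (w : List V × V) :
    pathLaw P a (hitCylinder bd w) = hitWeight P bd a w := by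
  classical
  by_cases hw : ∃ a', IsHittingWalk bd a' w
  · obtain ⟨a', ha'⟩ := hw
    have hne : w.1 ≠ [] := by
      intro h
      simp [h, IsHittingWalk] at ha'
    rw [hitCylinder_eq_of_isHittingWalk ha', pathLaw_walkBefore, hitWeight,
      head?_append_of_ne_nil hne]
    congr 1
    exact propext ⟨fun h => ⟨h, ha'.2⟩, fun h => h.1⟩
  · have h0 : hitCylinder bd w = ∅ := by
      rw [Set.eq_empty_iff_forall_notMem]
      rintro ω ⟨h1, h2, h3⟩
      rw [hitsAt_iff, h2, h3] at h1
      refine hw ⟨w.1.head (List.length_pos_iff.1 h1.1), List.head?_eq_some_head _, h1.2.2, h1.2.1⟩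
    rw [h0, measure_empty, hitWeight, if_neg fun h => hw ⟨a, h⟩]

/-! ### Total weight of sets of families of walks. -/

section Families

variable {k : ℕ}

/-- The probability of the families of walks which belong to `F`. -/
noncomputable def familyMass (P : Kernel V V) (bd : Set V) (a : Fin k → V)
    (F : Set (Fin k → List V × V)) : ENNReal :=
  ∑' W : F, ∏ i, hitWeight P bd (a i) (W.1 i)

/-- There are countably many families of walks, and their cylinders are disjoint because the hitting
time is unique. -/
theorem pi_pathLaw_familyEvent [Countable V] [DiscreteMeasurableSpace V] (P : Kernel V V)
    [IsMarkovKernel P] (bd : Set V) (a : Fin k → V) (F : Set (Fin k → List V × V)) :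
    Measure.pi (fun i => pathLaw P (a i)) (familyEvent bd F) = familyMass P bd a F := by
  have h : familyEvent bd F = ⋃ W : F, Set.univ.pi fun i => hitCylinder bd (W.1 i) := by
    ext π
    simp [familyEvent]
  rw [h, measure_iUnion, familyMass]
  · refine tsum_congr fun W => ?_
    rw [Measure.pi_pi]
    exact Finset.prod_congr rfl fun i _ => pathLaw_hitCylinder P bd (a i) _
  · intro W W' hne
    refine Set.disjoint_left.2 fun π hπ hπ' => hne (Subtype.ext (funext fun i => ?_))
    have h1 := hπ i trivial
    exact (eq_of_mem_hitCylinder h1.1 h1).trans (eq_of_mem_hitCylinder h1.1 (hπ' i trivial)).symm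
  · exact fun W => MeasurableSet.univ_pi fun i => measurableSet_hitCylinder _ _

/-- The families of walks which end in `B 0, …, B (k - 1)` respectively. -/
def endsIn (B : Fin k → Set V) : Set (Fin k → List V × V) := {W | ∀ i, (W i).2 ∈ B i}

theorem prod_hitProb [Countable V] [DiscreteMeasurableSpace V] (P : Kernel V V)
    [IsMarkovKernel P] (bd : Set V) (a : Fin k → V) (B : Fin k → Set V) :
    ∏ i, hitProb P bd (a i) (B i) = (familyMass P bd a (endsIn B)).toReal := by
  rw [← pi_pathLaw_familyEvent]
  have h : familyEvent bd (endsIn B) =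
      Set.univ.pi fun i => {ω | ∃ n, HitsAt bd ω n ∧ ω n ∈ B i} := by
    ext π
    simp only [mem_familyEvent, endsIn, Set.mem_ofPred_eq, Set.mem_pi, Set.mem_univ, true_imp_iff]
    constructor
    · rintro ⟨n, h1, h2⟩ i
      exact ⟨n i, h1 i, h2 i⟩
    · intro h
      choose n hn using h
      exact ⟨n, fun i => (hn i).1, fun i => (hn i).2⟩
  rw [h, Measure.pi_pi, ENNReal.toReal_prod]
  rfl

theorem familyMass_ne_top [Countable V] [DiscreteMeasurableSpace V] (P : Kernel V V)
    [IsMarkovKernel P] (bd : Set V) (a : Fin k → V) (F : Set (Fin k → List V × V)) :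
    familyMass P bd a F ≠ ⊤ := by
  rw [← pi_pathLaw_familyEvent]
  exact measure_ne_top _ _

theorem familyMass_inter_add_diff (P : Kernel V V) (bd : Set V) (a : Fin k → V)
    (F G : Set (Fin k → List V × V)) :
    familyMass P bd a (F ∩ G) + familyMass P bd a (F \ G) = familyMass P bd a F := by
  unfold familyMass
  have h := ENNReal.summable.tsum_union_disjoint (f := fun W => ∏ i, hitWeight P bd (a i) (W i))
    (Set.disjoint_sdiff_inter (s := F) (t := G)).symm ENNReal.summable
  rw [Set.inter_union_sdiff] at h
  exact h.symm

/-- Lets combinatorial facts be checked only on families of possible trajectories, where the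
crossing hypothesis is available. -/
theorem familyMass_congr {P : Kernel V V} {bd : Set V} {a : Fin k → V}
    {F G : Set (Fin k → List V × V)}
    (h : ∀ W, (∀ i, hitWeight P bd (a i) (W i) ≠ 0) → (W ∈ F ↔ W ∈ G)) :
    familyMass P bd a F = familyMass P bd a G := by
  unfold familyMass
  rw [tsum_subtype F (fun W => ∏ i, hitWeight P bd (a i) (W i)),
    tsum_subtype G (fun W => ∏ i, hitWeight P bd (a i) (W i))]
  refine tsum_congr fun W => ?_
  by_cases hW : ∀ i, hitWeight P bd (a i) (W i) ≠ 0
  · by_cases hF : W ∈ F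
    · simp [hF, (h W hW).1 hF]
    · simp [hF, mt (h W hW).2 hF]
  · push Not at hW
    obtain ⟨i, hi⟩ := hW
    have : ∏ i, hitWeight P bd (a i) (W i) = 0 := Finset.prod_eq_zero (Finset.mem_univ i) hi
    simp [Set.indicator, this]

theorem familyMass_le_of_injOn {P : Kernel V V} {bd : Set V} {a : Fin k → V}
    {F G : Set (Fin k → List V × V)} (φ : (Fin k → List V × V) → Fin k → List V × V)
    (hmaps : Set.MapsTo φ F G) (hinj : Set.InjOn φ F)
    (hweight : ∀ W ∈ F, ∏ i, hitWeight P bd (a i) (φ W i) = ∏ i, hitWeight P bd (a i) (W i)) :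
    familyMass P bd a F ≤ familyMass P bd a G := by
  unfold familyMass
  have hi : Function.Injective (hmaps.restrict φ F G) := (Set.MapsTo.restrict_inj hmaps).2 hinj
  refine le_trans (le_of_eq ?_) (ENNReal.tsum_comp_le_tsum_of_injective hi _)
  exact tsum_congr fun W => (hweight W.1 W.2).symm

end Families

end HittingWalks

/-! ### Loop erasure under concatenation. -/

section LoopErasureLemmas

variable {V : Type*}

theorem nodup_eraseStep {L : List V} (h : L.Nodup) (v : V) : (eraseStep L v).Nodup := by
  rw [eraseStep, List.nodup_append]
  refine ⟨h.sublist (List.takeWhile_sublist _), by simp, ?_⟩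
  intro u hu w hw
  simpa [List.mem_singleton.1 hw] using List.mem_takeWhile_imp hu

theorem nodup_loopErase (l : List V) : (loopErase l).Nodup := by
  induction l using List.reverseRecOn with
  | nil => exact List.nodup_nil
  | append_singleton l v ih =>
    rw [loopErase_append_singleton]
    exact nodup_eraseStep ih v

theorem eraseStep_append_cons {K : List V} {v : V} (h : v ∉ K) (N : List V) :
    eraseStep (K ++ v :: N) v = K ++ [v] := by
  rw [eraseStep, List.takeWhile_append_of_pos]
  · simp
  · intro u hu
    simp only [decide_eq_true_eq]
    rintro rfl
    exact h hu

theorem eraseStep_append_cons_of_notMem {K : List V} {x v : V} (h : x ∉ K) (hx : x ≠ v)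
    (N : List V) : eraseStep (K ++ v :: N) x = K ++ v :: eraseStep N x := by
  rw [eraseStep, List.takeWhile_append_of_pos]
  · rw [List.takeWhile_cons_of_pos (by simpa using hx.symm), eraseStep]
    simp
  · intro u hu
    simp only [decide_eq_true_eq]
    rintro rfl
    exact h hu

theorem mem_eraseStep {L : List V} {u v : V} (h : u ∈ eraseStep L v) : u ∈ L ∨ u = v := by
  rw [eraseStep, List.mem_append, List.mem_singleton] at h
  exact h.imp_left fun h => (List.takeWhile_prefix _).subset h

theorem mem_foldl_eraseStep {L t : List V} {u : V} (h : u ∈ t.foldl eraseStep L) :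
    u ∈ L ∨ u ∈ t := by
  induction t generalizing L with
  | nil => exact Or.inl h
  | cons x t ih =>
    rcases ih h with h | h
    · rcases mem_eraseStep h with h | rfl
      · exact Or.inl h
      · simp
    · simp [h]

theorem foldl_eraseStep_append_cons {K t : List V} {v : V} (hv : v ∉ t) (hK : ∀ x ∈ t, x ∉ K)
    (N : List V) : ∃ N', t.foldl eraseStep (K ++ v :: N) = K ++ v :: N' := by
  induction t generalizing N with
  | nil => exact ⟨N, rfl⟩
  | cons x t ih =>
    simp only [List.mem_cons, not_or, forall_eq_or_imp] at hv hK
    rw [List.foldl_cons, eraseStep_append_cons_of_notMem hK.1 (Ne.symm hv.1)]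
    exact ih hv.2 hK.2 _

/-- A step of `t` onto `K` would close a loop containing `v` and erase it; as `t` never returns to
`v`, it could not reappear. -/
theorem notMem_of_mem_foldl_eraseStep {K t : List V} {v : V} (hv : v ∉ t) (hvK : v ∉ K)
    (N : List V) (h : v ∈ t.foldl eraseStep (K ++ v :: N)) : ∀ x ∈ t, x ∉ K := by
  induction t generalizing N with
  | nil => simp
  | cons x t ih =>
    simp only [List.mem_cons, not_or] at hv
    rw [List.foldl_cons] at h
    have hx : x ∉ K := by
      intro hx
      obtain ⟨K₁, K₂, rfl, hK₁⟩ := List.eq_append_cons_of_mem hx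
      rw [List.append_assoc, List.cons_append, eraseStep_append_cons hK₁] at h
      rcases mem_foldl_eraseStep h with h | h
      · apply hvK
        simp only [List.mem_append, List.mem_cons] at h ⊢
        tauto
      · exact hv.2 h
    rw [eraseStep_append_cons_of_notMem hx (Ne.symm hv.1)] at h
    simp only [List.mem_cons, forall_eq_or_imp]
    exact ⟨hx, ih hv.2 _ h⟩

theorem loopErase_append (l t : List V) : loopErase (l ++ t) = t.foldl eraseStep (loopErase l) := by
  simp [loopErase, List.foldl_append]

theorem append_cons_inj_of_notMem_left {K L M N : List V} {v : V} (hK : v ∉ K) (hL : v ∉ L)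
    (h : K ++ v :: N = L ++ v :: M) : K = L := by
  have := eraseStep_append_cons hK N
  rw [h, eraseStep_append_cons hL] at this
  exact (List.append_cancel_right this).symm

theorem exists_loopErase_append_singleton (p : List V) (v : V) :
    ∃ K, v ∉ K ∧ loopErase (p ++ [v]) = K ++ [v] := by
  refine ⟨_, fun h => ?_, loopErase_append_singleton p v⟩
  simpa using List.mem_takeWhile_imp h

/-- If a vertex `v` of the loop-erased walk is last visited before `t`, then the loop-erased walk
up to `v` is determined by the walk up to this visit, and `t` avoids it. -/
theorem loopErase_prefix_of_last_visit {p t L M : List V} {v : V} (hv : v ∉ t)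
    (h : loopErase (p ++ v :: t) = L ++ v :: M) :
    loopErase (p ++ [v]) = L ++ [v] ∧ ∀ x ∈ t, x ∉ L := by
  obtain ⟨K, hK, he⟩ := exists_loopErase_append_singleton p v
  have hL : v ∉ L := by
    have := nodup_loopErase (p ++ v :: t)
    rw [h, List.nodup_append] at this
    exact fun hv => this.2.2 v hv v (by simp) rfl
  rw [show p ++ v :: t = (p ++ [v]) ++ t by simp, loopErase_append, he] at h
  have hKt := notMem_of_mem_foldl_eraseStep hv hK [] (by rw [h]; simp)
  obtain ⟨N', hN'⟩ := foldl_eraseStep_append_cons hv hKt []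
  rw [hN'] at h
  obtain rfl := append_cons_inj_of_notMem_left hK hL h
  exact ⟨he, hKt⟩

theorem loopErase_append_cons_of_disjoint {p t L : List V} {v : V}
    (h : loopErase (p ++ [v]) = L ++ [v]) (hv : v ∉ t) (hL : ∀ x ∈ t, x ∉ L) :
    ∃ M, loopErase (p ++ v :: t) = L ++ v :: M := by
  rw [show p ++ v :: t = (p ++ [v]) ++ t by simp, loopErase_append, h]
  exact foldl_eraseStep_append_cons hv hL []

theorem getLast?_loopErase (l : List V) : (loopErase l).getLast? = l.getLast? := by
  induction l using List.reverseRecOn with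
  | nil => rfl
  | append_singleton l v ih => simp [loopErase_append_singleton, eraseStep]

theorem head?_loopErase (l : List V) : (loopErase l).head? = l.head? := by
  induction l using List.reverseRecOn with
  | nil => rfl
  | append_singleton l v ih =>
    rw [loopErase_append_singleton]
    cases l with
    | nil => simp [loopErase, eraseStep]
    | cons u l =>
      rw [List.cons_append, List.head?_cons, ← List.head?_cons (l := l), ← ih]
      by_cases hv : v ∈ loopErase (u :: l)
      · obtain ⟨K, N, h, hK⟩ := List.eq_append_cons_of_mem hv
        rw [h, eraseStep_append_cons hK]
        cases K <;> rfl
      · rw [eraseStep_of_notMem hv, head?_append_of_ne_nil]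
        intro h0
        simp [h0] at ih

/-- A step either truncates the erased walk to a prefix or extends it; in the latter case the new
transition is one of the original walk, since both end at the same state. -/
theorem isChain_loopErase {R : V → V → Prop} {l : List V} (h : l.IsChain R) :
    (loopErase l).IsChain R := by
  induction l using List.reverseRecOn with
  | nil => exact List.isChain_nil
  | append_singleton l v ih =>
    rw [List.isChain_append] at h
    have ih := ih h.1
    rw [loopErase_append_singleton]
    by_cases hv : v ∈ loopErase l
    · obtain ⟨K, N, he, hK⟩ := List.eq_append_cons_of_mem hv
      rw [he, eraseStep_append_cons hK]
      rw [he, show K ++ v :: N = (K ++ [v]) ++ N by simp] at ih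
      exact ih.left_of_append
    · rw [eraseStep_of_notMem hv, List.isChain_append, getLast?_loopErase]
      exact ⟨ih, h.2⟩

/-- The loop-erased part of a walk whose states after the start lie outside of `bd` has the
same property. -/
theorem notMem_of_mem_tail_loopErase {bd : Set V} {l : List V} (h : ∀ x ∈ l.tail, x ∉ bd) :
    ∀ x ∈ (loopErase l).tail, x ∉ bd := by
  cases l with
  | nil => simp [loopErase]
  | cons a l =>
    have hh := head?_loopErase (a :: l)
    have hn := nodup_loopErase (a :: l)
    intro x hx
    have hmem := mem_of_mem_loopErase (List.mem_of_mem_tail hx)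
    rcases hle : loopErase (a :: l) with _ | ⟨b, L⟩
    · simp [hle] at hx
    · rw [hle] at hh hn hx
      obtain rfl : b = a := by simpa using hh
      -- The start may lie in `bd`, but it does not recur in the self-avoiding erased walk.
      have : x ≠ b := by
        rintro rfl
        exact (List.nodup_cons.1 hn).1 hx
      exact h x (by simpa [this] using hmem)

end LoopErasureLemmas

/-! ### Cutting a walk at its last visit to a vertex. -/

section LastVisit

variable {V : Type*}

open scoped Classical in
/-- The part of a walk up to its last visit to `v`, included. -/
noncomputable def upToLast (v : V) (l : List V) : List V := l.rdropWhile fun u => decide (u ≠ v)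

open scoped Classical in
/-- The part of a walk after its last visit to `v`. -/
noncomputable def afterLast (v : V) (l : List V) : List V := l.rtakeWhile fun u => decide (u ≠ v)

theorem upToLast_append_afterLast (v : V) (l : List V) : upToLast v l ++ afterLast v l = l :=
  List.rdropWhile_append_rtakeWhile

theorem notMem_afterLast (v : V) (l : List V) : v ∉ afterLast v l := by
  intro h
  simpa using List.mem_rtakeWhile_imp h

theorem upToLast_append {v : V} (p : List V) {q : List V} (hq : v ∉ q) :
    upToLast v (p ++ v :: q) = p ++ [v] := by
  induction q using List.reverseRecOn with
  | nil => exact List.rdropWhile_concat_neg _ _ _ (by simp)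
  | append_singleton q x ih =>
    simp only [List.mem_append, List.mem_singleton, not_or] at hq
    rw [show p ++ v :: (q ++ [x]) = (p ++ v :: q) ++ [x] by simp, upToLast,
      List.rdropWhile_concat_pos _ _ _ (by simpa using Ne.symm hq.2)]
    exact ih hq.1

theorem afterLast_append {v : V} (p : List V) {q : List V} (hq : v ∉ q) :
    afterLast v (p ++ v :: q) = q := by
  have h := upToLast_append_afterLast v (p ++ v :: q)
  rw [upToLast_append p hq, List.append_assoc] at h
  simpa using h

theorem exists_upToLast_eq {v : V} {l : List V} (h : v ∈ l) : ∃ p, upToLast v l = p ++ [v] := by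
  obtain ⟨p, q, hpq, hp⟩ := List.eq_append_cons_of_mem (List.mem_reverse.2 h)
  have : l = q.reverse ++ v :: p.reverse := by
    rw [← List.reverse_reverse l, hpq]
    simp
  exact ⟨q.reverse, by rw [this, upToLast_append _ (by simpa using hp)]⟩

/-- The grafted tail avoids `v`, so the cut point is unchanged; with `afterLast_splice` this makes
tail exchange an involution. -/
theorem upToLast_splice {v : V} {l : List V} (h : v ∈ l) (l' : List V) :
    upToLast v (upToLast v l ++ afterLast v l') = upToLast v l := by
  obtain ⟨p, hp⟩ := exists_upToLast_eq h
  rw [hp, List.append_assoc]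
  exact upToLast_append p (notMem_afterLast v l')

theorem afterLast_splice {v : V} {l : List V} (h : v ∈ l) (l' : List V) :
    afterLast v (upToLast v l ++ afterLast v l') = afterLast v l' := by
  obtain ⟨p, hp⟩ := exists_upToLast_eq h
  rw [hp, List.append_assoc]
  exact afterLast_append p (notMem_afterLast v l')

theorem mem_upToLast {v : V} {l : List V} (h : v ∈ l) : v ∈ upToLast v l := by
  obtain ⟨p, hp⟩ := exists_upToLast_eq h
  simp [hp]

theorem mem_of_mem_upToLast {u v : V} {l : List V} (h : u ∈ upToLast v l) : u ∈ l := by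
  rw [← upToLast_append_afterLast v l]
  exact List.mem_append_left _ h

theorem mem_of_mem_afterLast {u v : V} {l : List V} (h : u ∈ afterLast v l) : u ∈ l := by
  rw [← upToLast_append_afterLast v l]
  exact List.mem_append_right _ h

theorem mem_tail_of_mem_afterLast {u v : V} {l : List V} (hv : v ∈ l) (h : u ∈ afterLast v l) :
    u ∈ l.tail := by
  obtain ⟨p, hp⟩ := exists_upToLast_eq hv
  rw [← upToLast_append_afterLast v l, hp]
  cases p <;> simp [h]

end LastVisit

/-! ### First crossings and the exchange of tails. -/

section TailSwap

variable {V : Type*} {k : ℕ}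

/-- No walk of the family meets the loop-erased part of an earlier one outside of `bd`. -/
def NonCrossing (bd : Set V) (W : Fin k → List V × V) : Prop :=
  ∀ i j, i < j → ∀ v ∈ loopErase (W i).1, v ∉ bd → v ∉ (W j).1

/-- The first crossing of the family: `i` is the first index such that the loop-erased part
of `W i` meets a later walk outside of `bd`, `v` is the first such vertex on it, and `W j` is
the first later walk through `v`. -/
structure FirstCrossing (bd : Set V) (W : Fin k → List V × V) (i j : Fin k) (v : V) : Prop where
  notMem_bd : v ∉ bd
  lt : i < j
  mem_right : v ∈ (W j).1
  between : ∀ j', i < j' → j' < j → v ∉ (W j').1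
  first : ∃ L M, loopErase (W i).1 = L ++ v :: M ∧
    ∀ u ∈ L, u ∉ bd → ∀ j', i < j' → u ∉ (W j').1
  before : ∀ i', i' < i → ∀ j', i' < j' → ∀ u ∈ loopErase (W i').1, u ∉ bd → u ∉ (W j').1

theorem FirstCrossing.mem_loopErase {bd : Set V} {W : Fin k → List V × V} {i j : Fin k} {v : V}
    (h : FirstCrossing bd W i j v) : v ∈ loopErase (W i).1 := by
  obtain ⟨L, M, h, -⟩ := h.first
  simp [h]

theorem FirstCrossing.mem_left {bd : Set V} {W : Fin k → List V × V} {i j : Fin k} {v : V}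
    (h : FirstCrossing bd W i j v) : v ∈ (W i).1 := mem_of_mem_loopErase h.mem_loopErase

theorem exists_first_of_exists {p : V → Prop} {l : List V} (h : ∃ v ∈ l, p v) :
    ∃ L v M, l = L ++ v :: M ∧ p v ∧ ∀ u ∈ L, ¬ p u := by
  induction l with
  | nil => simp at h
  | cons x l ih =>
    by_cases hx : p x
    · exact ⟨[], x, l, rfl, hx, by simp⟩
    · obtain ⟨v, hv, hpv⟩ := h
      rcases List.mem_cons.1 hv with rfl | hv
      · exact absurd hpv hx
      · obtain ⟨L, w, M, rfl, hw, hL⟩ := ih ⟨v, hv, hpv⟩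
        refine ⟨x :: L, w, M, rfl, hw, ?_⟩
        simpa [hx] using hL

theorem exists_firstCrossing {bd : Set V} {W : Fin k → List V × V} (h : ¬ NonCrossing bd W) :
    ∃ i j v, FirstCrossing bd W i j v := by
  classical
  let p : Fin k → V → Prop := fun i v => v ∉ bd ∧ ∃ j, i < j ∧ v ∈ (W j).1
  have h1 : ∃ i, ∃ v ∈ loopErase (W i).1, p i v := by
    unfold NonCrossing at h
    push Not at h
    obtain ⟨i, j, hij, v, hv, hvb, hvj⟩ := h
    exact ⟨i, v, hv, hvb, j, hij, hvj⟩
  -- The choices are made in the order `i`, then `v` along `LE(W i)`, then `j`, each as early as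
  -- possible.
  obtain ⟨i, hi, hmin⟩ := WellFounded.has_min (wellFounded_lt (α := Fin k)) {i | _} h1
  obtain ⟨L, v, M, hl, ⟨hvb, h2⟩, hL⟩ := exists_first_of_exists hi
  obtain ⟨j, ⟨hij, hvj⟩, hminj⟩ := WellFounded.has_min (wellFounded_lt (α := Fin k)) {j | _} h2
  refine ⟨i, j, v, hvb, hij, hvj, ?_, ⟨L, M, hl, ?_⟩, ?_⟩
  · exact fun j' h1 h2 h3 => hminj j' ⟨h1, h3⟩ h2
  · exact fun u hu hub j' hj' huj => hL u hu ⟨hub, j', hj', huj⟩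
  · exact fun i' hi' j' hj' u hu hub huj => hmin i' ⟨u, hu, hub, j', hj', huj⟩ hi'

theorem FirstCrossing.not_nonCrossing {bd : Set V} {W : Fin k → List V × V} {i j : Fin k} {v : V}
    (h : FirstCrossing bd W i j v) : ¬ NonCrossing bd W :=
  fun hn => hn i j h.lt v h.mem_loopErase h.notMem_bd h.mem_right

theorem FirstCrossing.unique {bd : Set V} {W : Fin k → List V × V} {i j i' j' : Fin k} {v v' : V}
    (h : FirstCrossing bd W i j v) (h' : FirstCrossing bd W i' j' v') :
    i = i' ∧ j = j' ∧ v = v' := by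
  obtain rfl : i = i' := by
    rcases lt_trichotomy i i' with hlt | rfl | hlt
    · exact absurd h.mem_right (h'.before i hlt j h.lt v h.mem_loopErase h.notMem_bd)
    · rfl
    · exact absurd h'.mem_right (h.before i' hlt j' h'.lt v' h'.mem_loopErase h'.notMem_bd)
  obtain ⟨L, M, hl, hL⟩ := h.first
  obtain ⟨L', M', hl', hL'⟩ := h'.first
  obtain rfl : v = v' := by
    have hv : v ∉ L' := fun hm => hL' v hm h.notMem_bd j h.lt h.mem_right
    have hv' : v' ∉ L := fun hm => hL v' hm h'.notMem_bd j' h'.lt h'.mem_right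
    -- If the two decompositions differed, the earlier vertex would lie in the prefix preceding the
    -- other.
    rw [hl, List.append_eq_append_iff] at hl'
    rcases hl' with ⟨A, rfl, hA⟩ | ⟨A, rfl, hA⟩
    · cases A with
      | nil => simpa using (List.cons.inj hA).1
      | cons x A =>
        obtain rfl := (List.cons.inj hA).1
        simp at hv
    · cases A with
      | nil => simpa using (List.cons.inj hA).1.symm
      | cons x A =>
        obtain rfl := (List.cons.inj hA).1
        simp at hv'
  refine ⟨rfl, ?_, rfl⟩
  rcases lt_trichotomy j j' with hlt | rfl | hlt
  · exact absurd h.mem_right (h'.between j h.lt hlt)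
  · rfl
  · exact absurd h'.mem_right (h.between j' h'.lt hlt)

/-- Exchange the tails of the `i`-th and of the `j`-th walk after their last visits to `v`. -/
noncomputable def swapTails (i j : Fin k) (v : V) (W : Fin k → List V × V) :
    Fin k → List V × V := fun m =>
  (upToLast v (W m).1 ++ afterLast v (W (Equiv.swap i j m)).1, (W (Equiv.swap i j m)).2)

theorem swapTails_of_ne {i j : Fin k} {v : V} {W : Fin k → List V × V} {m : Fin k} (hi : m ≠ i)
    (hj : m ≠ j) : swapTails i j v W m = W m := by
  rw [swapTails, Equiv.swap_apply_of_ne_of_ne hi hj, upToLast_append_afterLast]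

theorem mem_swapTails {i j : Fin k} {v u : V} {W : Fin k → List V × V} {m : Fin k}
    (h : u ∈ (swapTails i j v W m).1) : u ∈ (W m).1 ∨ u ∈ (W (Equiv.swap i j m)).1 :=
  (List.mem_append.1 h).imp mem_of_mem_upToLast mem_of_mem_afterLast

theorem swapTails_swapTails {i j : Fin k} {v : V} {W : Fin k → List V × V}
    (hi : v ∈ (W i).1) (hj : v ∈ (W j).1) : swapTails i j v (swapTails i j v W) = W := by
  funext m
  by_cases hm : m = i ∨ m = j
  · have h1 : v ∈ (W m).1 := by rcases hm with rfl | rfl <;> assumption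
    have h2 : v ∈ (W (Equiv.swap i j m)).1 := by rcases hm with rfl | rfl <;> simpa
    simp only [swapTails, Equiv.swap_apply_self]
    rw [upToLast_splice h1, afterLast_splice h2, upToLast_append_afterLast]
  · rw [not_or] at hm
    rw [swapTails_of_ne hm.1 hm.2, swapTails_of_ne hm.1 hm.2]

theorem isHittingWalk_splice {bd : Set V} {a a' v : V} {w w' : List V × V}
    (h : IsHittingWalk bd a w) (h' : IsHittingWalk bd a' w') (hv : v ∈ w.1) (hv' : v ∈ w'.1) :
    IsHittingWalk bd a (upToLast v w.1 ++ afterLast v w'.1, w'.2) := by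
  have hne : upToLast v w.1 ≠ [] := List.ne_nil_of_mem (mem_upToLast hv)
  refine ⟨?_, ?_, h'.2.2⟩
  · rw [head?_append_of_ne_nil hne, ← h.1, ← head?_append_of_ne_nil hne (afterLast v w.1),
      upToLast_append_afterLast]
  · intro x hx
    rw [List.tail_append_of_ne_nil hne, List.mem_append] at hx
    rcases hx with hx | hx
    · refine h.2.1 x ?_
      rw [← upToLast_append_afterLast v w.1, List.tail_append_of_ne_nil hne]
      exact List.mem_append_left _ hx
    · exact h'.2.1 x (mem_tail_of_mem_afterLast hv' hx)

theorem isHittingWalk_swapTails {bd : Set V} {a : Fin k → V} {i j : Fin k} {v : V}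
    {W : Fin k → List V × V} (h : ∀ m, IsHittingWalk bd (a m) (W m))
    (hi : v ∈ (W i).1) (hj : v ∈ (W j).1) (m : Fin k) :
    IsHittingWalk bd (a m) (swapTails i j v W m) := by
  by_cases hm : m = i ∨ m = j
  · have h1 : v ∈ (W m).1 := by rcases hm with rfl | rfl <;> assumption
    have h2 : v ∈ (W (Equiv.swap i j m)).1 := by rcases hm with rfl | rfl <;> simpa
    exact isHittingWalk_splice (h m) (h _) h1 h2
  · rw [not_or] at hm
    rw [swapTails_of_ne hm.1 hm.2]
    exact h m

/-- Let `L` be the part of `LE(W i)` before `v`. Both tails avoid `L`: that of `W i` because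
otherwise `v` would have been erased, that of `W j` because `v` is the first crossing vertex. So `L`
is still the part before `v`, and no later walk acquires a vertex of `L` in the interior. -/
theorem FirstCrossing.swapTails {bd : Set V} {a : Fin k → V} {i j : Fin k} {v : V}
    {W : Fin k → List V × V} (h : FirstCrossing bd W i j v)
    (hW : ∀ m, IsHittingWalk bd (a m) (W m)) : FirstCrossing bd (swapTails i j v W) i j v := by
  have hvi := h.mem_left
  have hvj := h.mem_right
  have hbefore : ∀ i', i' < i → HittingLE.swapTails i j v W i' = W i' := fun i' hi' =>
    swapTails_of_ne hi'.ne (hi'.trans h.lt).ne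
  obtain ⟨L, M, hl, hL⟩ := h.first
  obtain ⟨p, hp⟩ := exists_upToLast_eq hvi
  have hsplit : (W i).1 = p ++ v :: afterLast v (W i).1 := by
    conv_lhs => rw [← upToLast_append_afterLast v (W i).1, hp]
    simp
  have hvL : v ∉ L := by
    have := nodup_loopErase (W i).1
    rw [hl, List.nodup_append] at this
    exact fun hv => this.2.2 v hv v (by simp) rfl
  have hpre : loopErase (p ++ [v]) = L ++ [v] ∧ ∀ x ∈ afterLast v (W i).1, x ∉ L :=
    loopErase_prefix_of_last_visit (notMem_afterLast v _) (hsplit ▸ hl)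
  refine ⟨h.notMem_bd, h.lt, ?_, ?_, ?_, ?_⟩
  · exact List.mem_append_left _ (mem_upToLast hvj)
  · intro j' h1 h2
    rw [swapTails_of_ne h1.ne' h2.ne]
    exact h.between j' h1 h2
  · have hdis : ∀ x ∈ afterLast v (W j).1, x ∉ L := by
      intro x hx hxL
      exact hL x hxL ((hW j).2.1 x (mem_tail_of_mem_afterLast hvj hx)) j h.lt
        (mem_of_mem_afterLast hx)
    obtain ⟨M', hM'⟩ := loopErase_append_cons_of_disjoint hpre.1 (notMem_afterLast v (W j).1) hdis
    refine ⟨L, M', ?_, ?_⟩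
    · rw [← hM', HittingLE.swapTails, Equiv.swap_apply_left, hp]
      simp
    · intro u hu hub j' hj'
      by_cases hjj : j' = j
      · subst hjj
        rw [HittingLE.swapTails, Equiv.swap_apply_right, List.mem_append, not_or]
        exact ⟨fun hm => hL u hu hub j' hj' (mem_of_mem_upToLast hm), fun hm => hpre.2 u hm hu⟩
      · rw [swapTails_of_ne hj'.ne' hjj]
        exact hL u hu hub j' hj'
  · intro i' hi' j' hj' u hu hub huj
    rw [hbefore i' hi'] at hu
    rcases mem_swapTails huj with huj | huj
    · exact h.before i' hi' j' hj' u hu hub huj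
    -- The walk that supplied the tail also has index greater than `i'`.
    · refine h.before i' hi' (Equiv.swap i j j') ?_ u hu hub huj
      rw [Equiv.swap_apply_def]
      split_ifs
      · exact hi'.trans h.lt
      · exact hi'
      · exact hj'

/-! ### Invariance of weights and cancellation. -/

section Weights

variable [MeasurableSpace V]

open scoped Classical in
/-- The weight of the initial part of a walk which starts at `a` and then avoids `bd`. -/
noncomputable def headWeight (P : Kernel V V) (bd : Set V) (a : V) (h : List V) : ENNReal :=
  if h.head? = some a ∧ ∀ x ∈ h.tail, x ∉ bd then walkWeight P h else 0

open scoped Classical in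
/-- The weight of the final part of a walk, from `v` to its first visit to `bd` at `b`. -/
noncomputable def tailWeight (P : Kernel V V) (bd : Set V) (v : V) (t : List V) (b : V) :
    ENNReal :=
  if (∀ x ∈ t, x ∉ bd) ∧ b ∈ bd then walkWeight P (v :: (t ++ [b])) else 0

/-- Both the weight and the condition of being a hitting walk factor at the cut. Taking `l' = l`
covers the unspliced walk. -/
theorem hitWeight_splice (P : Kernel V V) (bd : Set V) (a : V) {v : V} {l : List V} (hv : v ∈ l)
    (l' : List V) (b : V) :
    hitWeight P bd a (upToLast v l ++ afterLast v l', b) =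
      headWeight P bd a (upToLast v l) * tailWeight P bd v (afterLast v l') b := by
  classical
  obtain ⟨p, hp⟩ := exists_upToLast_eq hv
  have hne : p ++ [v] ≠ [] := by simp
  have hw : walkWeight P (p ++ [v] ++ afterLast v l' ++ [b]) =
      walkWeight P (p ++ [v]) * walkWeight P (v :: (afterLast v l' ++ [b])) := by
    rw [← walkWeight_append]
    simp
  rw [hp, hitWeight, headWeight, tailWeight, hw, ite_zero_mul_ite_zero]
  refine if_congr ?_ rfl rfl
  simp only [IsHittingWalk, head?_append_of_ne_nil hne, List.tail_append_of_ne_nil hne,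
    List.mem_append, or_imp, forall_and]
  tauto

theorem prod_hitWeight_swapTails (P : Kernel V V) (bd : Set V) (a : Fin k → V) {i j : Fin k}
    {v : V} {W : Fin k → List V × V} (hi : v ∈ (W i).1) (hj : v ∈ (W j).1) :
    ∏ m, hitWeight P bd (a m) (swapTails i j v W m) = ∏ m, hitWeight P bd (a m) (W m) := by
  classical
  -- `A` collects the factors that stay with the index, `C` those carried along by the
  -- transposition; at other indices everything goes into `C`.
  let A : Fin k → ENNReal := fun m =>
    if m = i ∨ m = j then headWeight P bd (a m) (upToLast v (W m).1) else 1
  let C : Fin k → ENNReal := fun m =>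
    if m = i ∨ m = j then tailWeight P bd v (afterLast v (W m).1) (W m).2
    else hitWeight P bd (a m) (W m)
  have hA : ∀ m, hitWeight P bd (a m) (W m) = A m * C m := by
    intro m
    by_cases hm : m = i ∨ m = j
    · have h1 : v ∈ (W m).1 := by rcases hm with rfl | rfl <;> assumption
      simp only [A, C, if_pos hm]
      rw [← hitWeight_splice P bd (a m) h1, upToLast_append_afterLast]
    · simp [A, C, hm]
  have hC : ∀ m, hitWeight P bd (a m) (swapTails i j v W m) = A m * C (Equiv.swap i j m) := by
    intro m
    by_cases hm : m = i ∨ m = j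
    · have h1 : v ∈ (W m).1 := by rcases hm with rfl | rfl <;> assumption
      have h2 : Equiv.swap i j m = i ∨ Equiv.swap i j m = j := by rcases hm with rfl | rfl <;> simp
      simp only [A, C, if_pos hm, if_pos h2]
      rw [← hitWeight_splice P bd (a m) h1, swapTails]
    · have hm' := not_or.1 hm
      rw [swapTails_of_ne hm'.1 hm'.2, Equiv.swap_apply_of_ne_of_ne hm'.1 hm'.2, hA]
  simp_rw [hA, hC, Finset.prod_mul_distrib]
  rw [Equiv.prod_comp (Equiv.swap i j) C]

/-- The families of walks of the chain with a given first crossing. -/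
def crossingSet (bd : Set V) (a : Fin k → V) (i j : Fin k) (v : V) : Set (Fin k → List V × V) :=
  {W | (∀ m, IsHittingWalk bd (a m) (W m)) ∧ FirstCrossing bd W i j v}

theorem familyMass_crossingSet_le (P : Kernel V V) (bd : Set V) (a : Fin k → V)
    (B : Fin k → Set V) (i j : Fin k) (v : V) :
    familyMass P bd a (endsIn B ∩ crossingSet bd a i j v) ≤
      familyMass P bd a (endsIn (B ∘ Equiv.swap i j) ∩ crossingSet bd a i j v) := by
  refine familyMass_le_of_injOn (swapTails i j v) ?_ ?_ ?_
  · rintro W ⟨hB, hW, h⟩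
    exact ⟨fun m => hB _, isHittingWalk_swapTails hW h.mem_left h.mem_right, h.swapTails hW⟩
  · rintro W ⟨-, -, h⟩ W' ⟨-, -, h'⟩ he
    rw [← swapTails_swapTails h.mem_left h.mem_right, he,
      swapTails_swapTails h'.mem_left h'.mem_right]
  · rintro W ⟨-, -, h⟩
    exact prod_hitWeight_swapTails P bd a h.mem_left h.mem_right

/-- The injection of `familyMass_crossingSet_le`, used for `B` and for `B ∘ Equiv.swap i j`, bounds
each side by the other. -/
theorem familyMass_crossingSet_swap (P : Kernel V V) (bd : Set V) (a : Fin k → V)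
    (B : Fin k → Set V) (i j : Fin k) (v : V) :
    familyMass P bd a (endsIn (B ∘ Equiv.swap i j) ∩ crossingSet bd a i j v) =
      familyMass P bd a (endsIn B ∩ crossingSet bd a i j v) := by
  refine le_antisymm ?_ (familyMass_crossingSet_le P bd a B i j v)
  refine (familyMass_crossingSet_le P bd a _ i j v).trans_eq ?_
  congr 2
  ext W
  simp [endsIn]

theorem isHittingWalk_of_hitWeight_ne_zero {P : Kernel V V} {bd : Set V} {a : V} {w : List V × V}
    (h : hitWeight P bd a w ≠ 0) : IsHittingWalk bd a w := by
  by_contra hw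
  exact h (if_neg hw)

theorem familyMass_crossing (P : Kernel V V) (bd : Set V) (a : Fin k → V) (B : Fin k → Set V) :
    familyMass P bd a (endsIn B \ {W | NonCrossing bd W}) =
      ∑ i, ∑ j, ∑' v, familyMass P bd a (endsIn B ∩ crossingSet bd a i j v) := by
  have h : familyMass P bd a (endsIn B \ {W | NonCrossing bd W}) = familyMass P bd a
      (⋃ t : Fin k × Fin k × V, endsIn B ∩ crossingSet bd a t.1 t.2.1 t.2.2) := by
    refine familyMass_congr fun W hW => ?_
    simp only [Set.mem_iUnion, Prod.exists]
    constructor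
    · rintro ⟨hB, hn⟩
      obtain ⟨i, j, v, hc⟩ := exists_firstCrossing hn
      exact ⟨i, j, v, hB, fun m => isHittingWalk_of_hitWeight_ne_zero (hW m), hc⟩
    · rintro ⟨i, j, v, hB, -, hc⟩
      exact ⟨hB, hc.not_nonCrossing⟩
  rw [h, familyMass, ENNReal.tsum_biUnion
    (f := fun W : Fin k → List V × V => ∏ i, hitWeight P bd (a i) (W i))]
  · have h1 : ∀ f : Fin k → Fin k → V → ENNReal,
        ∑' t : Fin k × Fin k × V, f t.1 t.2.1 t.2.2 = ∑ i, ∑ j, ∑' v, f i j v := by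
      intro f
      rw [ENNReal.tsum_prod (f := fun i (t : Fin k × V) => f i t.1 t.2), tsum_fintype]
      refine Finset.sum_congr rfl fun i _ => ?_
      rw [ENNReal.tsum_prod (f := f i), tsum_fintype]
    exact h1 fun i j v => familyMass P bd a (endsIn B ∩ crossingSet bd a i j v)
  · rintro ⟨i, j, v⟩ - ⟨i', j', v'⟩ - hne
    refine Set.disjoint_left.2 fun W hW hW' => hne ?_
    obtain ⟨rfl, rfl, rfl⟩ := hW.2.2.unique hW'.2.2
    rfl

/-- The contributions of the crossing families to the determinant cancel. -/
theorem sum_sign_familyMass_crossing (P : Kernel V V) (bd : Set V) (a : Fin k → V)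
    (B : Fin k → Set V) (hfin : ∀ F, familyMass P bd a F ≠ ⊤) :
    ∑ σ : Equiv.Perm (Fin k), (Equiv.Perm.sign σ : ℝ) *
      (familyMass P bd a (endsIn (B ∘ σ) \ {W | NonCrossing bd W})).toReal = 0 := by
  let M : Fin k → Fin k → Equiv.Perm (Fin k) → ENNReal := fun i j σ =>
    ∑' v, familyMass P bd a (endsIn (B ∘ σ) ∩ crossingSet bd a i j v)
  have hM : ∀ σ, ∑ i, ∑ j, M i j σ ≠ ⊤ := by
    intro σ
    rw [← familyMass_crossing]
    exact hfin _
  have hM' : ∀ σ i, ∑ j, M i j σ ≠ ⊤ := fun σ i =>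
    (ENNReal.sum_ne_top.1 (hM σ)) i (Finset.mem_univ i)
  have hM'' : ∀ σ i j, M i j σ ≠ ⊤ := fun σ i j =>
    (ENNReal.sum_ne_top.1 (hM' σ i)) j (Finset.mem_univ j)
  have hsum : ∀ σ : Equiv.Perm (Fin k),
      (familyMass P bd a (endsIn (B ∘ σ) \ {W | NonCrossing bd W})).toReal =
        ∑ i, ∑ j, (M i j σ).toReal := by
    intro σ
    rw [familyMass_crossing, ENNReal.toReal_sum fun i _ => hM' σ i]
    exact Finset.sum_congr rfl fun i _ => ENNReal.toReal_sum fun j _ => hM'' σ i j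
  simp_rw [hsum, Finset.mul_sum]
  rw [Finset.sum_comm]
  refine Finset.sum_eq_zero fun i _ => ?_
  rw [Finset.sum_comm]
  refine Finset.sum_eq_zero fun j _ => ?_
  by_cases hij : i < j
  -- Reindexing by `σ ↦ σ * Equiv.swap i j` fixes the masses and flips the sign, so the sum equals
  -- its own negative.
  · have hinv : ∀ σ, M i j (σ * Equiv.swap i j) = M i j σ := fun σ =>
      tsum_congr fun v => familyMass_crossingSet_swap P bd a (B ∘ σ) i j v
    have h := Equiv.sum_comp (Equiv.mulRight (Equiv.swap i j))
      fun σ : Equiv.Perm (Fin k) => (Equiv.Perm.sign σ : ℝ) * (M i j σ).toReal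
    simp only [Equiv.coe_mulRight, hinv, Equiv.Perm.sign_mul, Equiv.Perm.sign_swap hij.ne] at h
    simp only [mul_neg, mul_one, Units.val_neg, Int.cast_neg, neg_mul,
      Finset.sum_neg_distrib] at h
    linarith
  · refine Finset.sum_eq_zero fun σ _ => ?_
    have : M i j σ = 0 := by
      refine ENNReal.tsum_eq_zero.2 fun v => ?_
      have : crossingSet bd a i j v = ∅ :=
        Set.eq_empty_iff_forall_notMem.2 fun W hW => hij hW.2.lt
      simp [this, familyMass]
    simp [this]

end Weights
end TailSwap

/-! ### Consequences of the crossing hypothesis. -/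

section Crossing

variable {V : Type*} {k : ℕ}

/-- No walk of the family meets the loop-erased part of the preceding one outside of `bd`. -/
def ConsecutiveNonCrossing (bd : Set V) (W : Fin k → List V × V) : Prop :=
  ∀ i j : Fin k, (i : ℕ) + 1 = j → ∀ v ∈ loopErase (W i).1, v ∉ bd → v ∉ (W j).1

theorem NonCrossing.consecutiveNonCrossing {bd : Set V} {W : Fin k → List V × V}
    (h : NonCrossing bd W) : ConsecutiveNonCrossing bd W :=
  fun i j hij => h i j (Fin.lt_def.2 (by omega))

/-- The terminal states lie in `bd`, so including or omitting them does not affect interior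
meetings. -/
theorem nonCrossingEvent_eq_familyEvent (bd : Set V) (B : Fin k → Set V) :
    nonCrossingEvent bd B = familyEvent bd (endsIn B ∩ {W | ConsecutiveNonCrossing bd W}) := by
  ext π
  rw [mem_familyEvent]
  simp only [nonCrossingEvent, endsIn, ConsecutiveNonCrossing, Set.mem_ofPred_eq, Set.mem_inter_iff,
    forall_and, and_assoc]
  refine exists_congr fun n => and_congr_right fun hn => and_congr_right fun _ => ?_
  refine forall_congr' fun i => forall_congr' fun j => forall_congr' fun _ => forall_congr' fun v =>
    ?_
  have hmem : v ∉ bd → (v ∈ loopErasedHit (π i) (n i) ↔ v ∈ loopErase (walkBefore (π i) (n i))) := by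
    intro hv
    have : v ≠ π i (n i) := fun h => hv (h ▸ (hn i).2.1)
    simp [loopErasedHit, this]
  have hwalk : v ∉ bd → ((∀ m ≤ n j, π j m ≠ v) ↔ v ∉ walkBefore (π j) (n j)) := by
    intro hv
    rw [mem_walkBefore]
    constructor
    · rintro h ⟨m, hm, he⟩
      exact h m hm.le he
    · intro h m hm he
      refine h ⟨m, lt_of_le_of_ne hm ?_, he⟩
      rintro rfl
      exact hv (he ▸ (hn j).2.1)
  constructor
  · intro h hv hvb
    exact (hwalk hvb).1 (h hvb ((hmem hvb).2 hv))
  · intro h hvb hv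
    exact (hwalk hvb).2 (h ((hmem hvb).1 hv) hvb)

variable [MeasurableSpace V]

theorem hitWeight_ne_zero {P : Kernel V V} {bd : Set V} {a : V} {w : List V × V} :
    hitWeight P bd a w ≠ 0 ↔
      IsHittingWalk bd a w ∧ List.IsChain (fun u v => P u {v} ≠ 0) (w.1 ++ [w.2]) := by
  rw [← walkWeight_ne_zero]
  by_cases h : IsHittingWalk bd a w <;> simp [hitWeight, h]

theorem hitWeight_loopErase_ne_zero {P : Kernel V V} {bd : Set V} {a : V} {w : List V × V}
    (h : hitWeight P bd a w ≠ 0) : hitWeight P bd a (loopErase w.1, w.2) ≠ 0 := by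
  rw [hitWeight_ne_zero] at h ⊢
  obtain ⟨⟨h1, h2, h3⟩, hc⟩ := h
  refine ⟨⟨(head?_loopErase _).trans h1, notMem_of_mem_tail_loopErase h2, h3⟩, ?_⟩
  rw [List.isChain_append] at hc ⊢
  rw [getLast?_loopErase]
  exact ⟨isChain_loopErase hc.1, hc.2⟩

theorem hitWeight_splice_ne_zero {P : Kernel V V} {bd : Set V} {a a' v : V} {w w' : List V × V}
    (h : hitWeight P bd a w ≠ 0) (h' : hitWeight P bd a' w' ≠ 0) (hv : v ∈ w.1) (hv' : v ∈ w'.1) :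
    hitWeight P bd a (upToLast v w.1 ++ afterLast v w'.1, w'.2) ≠ 0 := by
  have e := hitWeight_splice P bd a hv w.1 w.2
  have e' := hitWeight_splice P bd a' hv' w'.1 w'.2
  rw [upToLast_append_afterLast] at e e'
  rw [Prod.mk.eta] at e e'
  rw [e] at h
  rw [e'] at h'
  rw [hitWeight_splice P bd a hv]
  exact mul_ne_zero (left_ne_zero_of_mul h) (right_ne_zero_of_mul h')

theorem exists_isPossibleTrajectory {P : Kernel V V} {bd : Set V} {a : V} {w : List V × V}
    {B : Set V} (h : hitWeight P bd a w ≠ 0) (hB : w.2 ∈ B) :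
    ∃ ω, IsPossibleTrajectory P bd a B ω w.1.length ∧ walkBefore ω w.1.length = w.1 := by
  obtain ⟨⟨h1, h2, h3⟩, hc⟩ := hitWeight_ne_zero.1 h
  obtain ⟨l, b⟩ := w
  simp only at h1 h2 h3 hc hB ⊢
  -- The continuation after the hit is irrelevant; it stays at `b`.
  let ω : ℕ → V := fun m => (l ++ [b]).getD m b
  have hω : ∀ m (hm : m < (l ++ [b]).length), ω m = (l ++ [b])[m] := fun m hm => by
    simp only [ω, List.getD_eq_getElem _ _ hm]
  have hw : walkBefore ω l.length = l := by
    refine List.ext_getElem (by simp) fun m hm hm' => ?_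
    simp only [walkBefore, List.getElem_map, List.getElem_range]
    rw [hω m (by simp; omega), List.getElem_append_left hm']
  have hb : ω l.length = b := by
    rw [hω _ (by simp)]
    simp
  have hl : 0 < l.length := by
    rw [List.length_pos_iff]
    rintro rfl
    simp at h1
  refine ⟨ω, ⟨?_, ?_, ?_, ?_⟩, hw⟩
  · rw [hω 0 (by simp), List.getElem_append_left hl]
    rw [List.head?_eq_getElem?, List.getElem?_eq_getElem hl] at h1
    simpa using h1
  · rw [hitsAt_iff, hw, hb]
    exact ⟨hl, h3, h2⟩
  · rwa [hb]
  · intro m hm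
    rw [hω m (by simp; omega), hω (m + 1) (by simpa using hm)]
    exact List.isChain_iff_getElem.1 hc m (by simpa using hm)

theorem CrossingHypothesis.exists_common {P : Kernel V V} {bd : Set V} {a : Fin k → V}
    {B : Fin k → Set V} (hcross : CrossingHypothesis P bd a B) {i i' j j' : Fin k} (hi : i < i')
    (hj : j' < j) {w w' : List V × V} (hw : hitWeight P bd (a i) w ≠ 0)
    (hw' : hitWeight P bd (a i') w' ≠ 0) (hB : w.2 ∈ B j) (hB' : w'.2 ∈ B j') :
    ∃ v ∉ bd, v ∈ w.1 ∧ v ∈ w'.1 := by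
  obtain ⟨ω, h, he⟩ := exists_isPossibleTrajectory hw hB
  obtain ⟨ω', h', he'⟩ := exists_isPossibleTrajectory hw' hB'
  obtain ⟨m, hm, m', hm', heq, hbd⟩ := hcross i i' j j' hi hj _ _ _ _ h h'
  refine ⟨ω m, hbd, ?_, ?_⟩
  · rw [← he, mem_walkBefore]
    refine ⟨m, lt_of_le_of_ne hm ?_, rfl⟩
    rintro rfl
    exact hbd h.hits.2.1
  · rw [← he', mem_walkBefore]
    refine ⟨m', lt_of_le_of_ne hm' ?_, heq.symm⟩
    rintro rfl
    exact hbd (heq ▸ h'.hits.2.1)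

theorem exists_inversion {σ : Equiv.Perm (Fin k)} (h : σ ≠ 1) : ∃ i i', i < i' ∧ σ i' < σ i := by
  by_contra! hn
  have hs : StrictMono σ := fun i i' hi => (hn i i' hi).lt_of_ne (σ.injective.ne hi.ne)
  refine h (Equiv.ext fun i => ?_)
  -- `Fin k` has only one order automorphism.
  exact DFunLike.congr_fun (Subsingleton.elim (hs.orderIsoOfSurjective σ σ.surjective)
    (OrderIso.refl (Fin k))) i

/-- A possible noncrossing family connects its starting points to the target sets in order. -/
theorem NonCrossing.perm_eq_one {P : Kernel V V} {bd : Set V} {a : Fin k → V} {B : Fin k → Set V}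
    (hcross : CrossingHypothesis P bd a B) {W : Fin k → List V × V} (hn : NonCrossing bd W)
    (hW : ∀ i, hitWeight P bd (a i) (W i) ≠ 0) {σ : Equiv.Perm (Fin k)}
    (hB : W ∈ endsIn (B ∘ σ)) : σ = 1 := by
  by_contra h
  obtain ⟨i, i', hi, hσ⟩ := exists_inversion h
  obtain ⟨v, hv, h1, h2⟩ := hcross.exists_common hi hσ (hitWeight_loopErase_ne_zero (hW i))
    (hW i') (hB i) (hB i')
  exact hn i i' hi v h1 hv h2

/-- Induction on `j - i`. If `LE(W i)` met `W j` at `v`, following the first to `v` and then the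
second would connect `a i` to `B j`, so it would meet `LE(W m)` with `m = i + 1`. A meeting on the
first piece contradicts the consecutive condition for `i, m`; one on the second contradicts the
induction hypothesis for `m, j`. -/
theorem ConsecutiveNonCrossing.nonCrossing {P : Kernel V V} {bd : Set V} {a : Fin k → V}
    {B : Fin k → Set V} (hcross : CrossingHypothesis P bd a B) {W : Fin k → List V × V}
    (hn : ConsecutiveNonCrossing bd W) (hW : ∀ i, hitWeight P bd (a i) (W i) ≠ 0)
    (hB : W ∈ endsIn B) : NonCrossing bd W := by
  suffices h : ∀ d : ℕ, ∀ i j : Fin k, (i : ℕ) + (d + 1) = j →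
      ∀ v ∈ loopErase (W i).1, v ∉ bd → v ∉ (W j).1 by
    intro i j hij
    exact h (j - i - 1) i j (by have : (i : ℕ) < j := hij; omega)
  intro d
  induction d with
  | zero => exact hn
  | succ d ih =>
    intro i j hij v hv hvb hvj
    have hm : (i : ℕ) + 1 < k := by omega
    let m : Fin k := ⟨i + 1, hm⟩
    have him : i < m := Nat.lt_succ_self _
    have hmj : m < j := Fin.lt_def.2 (by change (i : ℕ) + 1 < j; omega)
    have h1 := hn i m rfl
    have h2 := ih m j (by change (i : ℕ) + 1 + (d + 1) = j; omega)
    obtain ⟨u, hub, hu, hum⟩ := hcross.exists_common him hmj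
      (hitWeight_splice_ne_zero (hitWeight_loopErase_ne_zero (hW i)) (hW j) hv hvj)
      (hitWeight_loopErase_ne_zero (hW m)) (hB j) (hB m)
    rcases List.mem_append.1 hu with hu | hu
    · exact h1 u (mem_of_mem_upToLast hu) hub (mem_of_mem_loopErase hum)
    · exact h2 u hum hub (mem_of_mem_afterLast hu)

theorem det_hitProb [Countable V] [DiscreteMeasurableSpace V] (P : Kernel V V) [IsMarkovKernel P]
    (bd : Set V) (a : Fin k → V) (B : Fin k → Set V) (hcross : CrossingHypothesis P bd a B) :
    (Matrix.of fun i j => hitProb P bd (a i) (B j)).det =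
      (Measure.pi fun i => pathLaw P (a i)).real (nonCrossingEvent bd B) := by
  have hfin := familyMass_ne_top P bd a
  have hsplit : ∀ σ : Equiv.Perm (Fin k), ∏ i, hitProb P bd (a i) (B (σ i)) =
      (familyMass P bd a (endsIn (B ∘ σ) ∩ {W | NonCrossing bd W})).toReal +
        (familyMass P bd a (endsIn (B ∘ σ) \ {W | NonCrossing bd W})).toReal := by
    intro σ
    rw [← ENNReal.toReal_add (hfin _) (hfin _), familyMass_inter_add_diff]
    exact prod_hitProb P bd a (B ∘ σ)
  have hzero : ∀ σ : Equiv.Perm (Fin k), σ ≠ 1 →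
      familyMass P bd a (endsIn (B ∘ σ) ∩ {W | NonCrossing bd W}) = 0 := by
    intro σ hσ
    rw [familyMass_congr (G := ∅)]
    · simp [familyMass]
    · intro W hW
      simp only [Set.mem_empty_iff_false, iff_false]
      exact fun h => hσ (NonCrossing.perm_eq_one hcross h.2 hW h.1)
  have hone : familyMass P bd a (endsIn B ∩ {W | NonCrossing bd W}) =
      familyMass P bd a (endsIn B ∩ {W | ConsecutiveNonCrossing bd W}) :=
    familyMass_congr fun W hW => and_congr_right fun hB =>
      ⟨fun h => h.consecutiveNonCrossing, fun h => h.nonCrossing hcross hW hB⟩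
  -- Transposing makes the permutation act on the targets `B` instead of the starts.
  rw [← Matrix.det_transpose, Matrix.det_apply']
  simp only [Matrix.transpose_apply, Matrix.of_apply, hsplit, mul_add, Finset.sum_add_distrib]
  rw [sum_sign_familyMass_crossing P bd a B hfin, add_zero, Finset.sum_eq_single 1]
  · rw [Measure.real, nonCrossingEvent_eq_familyEvent, pi_pathLaw_familyEvent, ← hone]
    simp
  · intro σ _ hσ
    simp [hzero σ hσ]
  · simp

theorem CrossingHypothesis.comp {P : Kernel V V} {bd : Set V} {a : Fin k → V}
    {B : Fin k → Set V} (hcross : CrossingHypothesis P bd a B) {m : ℕ} {r c : Fin m → Fin k}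
    (hr : StrictMono r) (hc : StrictMono c) : CrossingHypothesis P bd (a ∘ r) (B ∘ c) :=
  fun _ _ _ _ hi hj => hcross _ _ _ _ (hr hi) (hc hj)

end Crossing

end HittingLE

theorem mainTheorem6 {V : Type*} [Countable V] [MeasurableSpace V] [DiscreteMeasurableSpace V]
    (P : Kernel V V) [IsMarkovKernel P] (bd : Set V) (k : ℕ)
    (a : Fin k → V) (ha : Function.Injective a)
    (B : Fin k → Set V) (hB : ∀ j, B j ⊆ bd) (hdisj : Pairwise (Function.onFun Disjoint B))
    (hcross : HittingLE.CrossingHypothesis P bd a B) :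
    0 ≤ (Matrix.of fun i j => HittingLE.hitProb P bd (a i) (B j)).det ∧
    HittingLE.TotallyNonneg (Matrix.of fun i j => HittingLE.hitProb P bd (a i) (B j)) ∧
    (Matrix.of fun i j => HittingLE.hitProb P bd (a i) (B j)).det =
      (Measure.pi fun i => HittingLE.pathLaw P (a i)).real
        (HittingLE.nonCrossingEvent bd B) := by
  have h := HittingLE.det_hitProb P bd a B hcross
  refine ⟨h ▸ measureReal_nonneg, fun m r c hr hc => ?_, h⟩
  have h' := HittingLE.det_hitProb P bd (a ∘ r) (B ∘ c) (hcross.comp hr hc)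
  exact h'.symm ▸ measureReal_nonneg
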